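/- Let $(\mathcal X,\mathcal A)$ be a measurable space, let $P$ be a probability measure on it, and let $\xi_1,\xi_2,\dots$ be i.i.d. random elements of $\mathcal X$ with law $P$. Let $\mathcal F$ be a collection of measurable functions $f:\mathcal X\to\mathbb R$ with $\int f^2\,dP<\infty$, and write $Pf=\int f\,dP$. Put $J_m=\{1,\dots,m\}$ and let $[y]$ denote the integer part of $y$. Let $(k^*_m)_{m\ge 0}$ be a sequence of nonnegative integers with $\lim_{n\to\infty}k^*_n/n=0$. For every $n\ge 1$ and $x\in[0,1]$ let $J_{k^*_{[nx]}}$ be an arbitrary (non-random) subset of $J_{[nx]}$ with $\min\{k^*_{[nx]},[nx]\}$ elements; the choice of the subset may depend on $n$ and $x$. Define the deleting-item sequential empirical process $$\tilde{\mathbb Z}_{(n,k^*)}(x,f)=\frac1{\sqrt n}\sum_{i\in J_{[nx]}\setminus J_{k^*_{[nx]}}}\bigl(f(\xi_i)-Pf\bigr),\qquad (x,f)\in[0,1]\times\mathcal F.$$ Then there exists a Gaussian process $\mathbb Z=\{\mathbb Z(x,f):(x,f)\in[0,1]\times\mathcal F\}$ (the Kiefer–Müller process) with mean zero and covariance $$\operatorname{cov}\bigl(\mathbb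 Z(s,f),\mathbb Z(t,g)\bigr)=(s\wedge t)\,(Pfg-Pf\,Pg),$$ and for any such process the finite-dimensional marginals of $\tilde{\mathbb Z}_{(n,k^*)}$ converge in distribution, as $n\to\infty$, to those of $\mathbb Z$: for all $(x_1,f_1),\dots,(x_r,f_r)\in[0,1]\times\mathcal F$, $$\bigl(\tilde{\mathbb Z}_{(n,k^*)}(x_1,f_1),\dots,\tilde{\mathbb Z}_{(n,k^*)}(x_r,f_r)\bigr)\xrightarrow{d}\bigl(\mathbb Z(x_1,f_1),\dots,\mathbb Z(x_r,f_r)\bigr).$$ -/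

import Mathlib

universe u v w
open MeasureTheory ProbabilityTheory Filter
open scoped unitInterval

/-- The integer part `[n x]`, as a natural number, for `x ∈ [0, 1]`. -/
noncomputable def intPart (n : ℕ) (x : I) : ℕ := ⌊(n : ℝ) * (x : ℝ)⌋₊

/-- The sequence `ξ` is indexed from `0`, so `ξ i` is the `(i + 1)`-st observation and
`Finset.range m` is the index set `J_m` of the first `m` observations.

`IsDeletionScheme k D` says that for every `n` and `x ∈ [0, 1]`, with `m = [n x]`, the set
`D n x` of deleted indices is a subset of `J_m` having `k m` elements (all of the `m` elements of
`J_m` in case `k m` exceeds `m`). The choice of the subset is otherwise arbitrary. -/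
def IsDeletionScheme (k : ℕ → ℕ) (D : ℕ → I → Finset ℕ) : Prop :=
  ∀ (n : ℕ) (x : I), D n x ⊆ Finset.range (intPart n x) ∧
    (D n x).card = min (k (intPart n x)) (intPart n x)

/-- The deleting-item sequential empirical process
`n^{-1/2} ∑_{i ∈ J_{[n x]} ∖ D n x} (f (ξ_i) - P f)`, indexed by `(x, f) ∈ [0, 1] × F`. -/
noncomputable def deletingEmpiricalProcess {Ω 𝓧 : Type*} [MeasurableSpace 𝓧]
    (P : Measure 𝓧) (F : Set (𝓧 → ℝ)) (ξ : ℕ → Ω → 𝓧) (D : ℕ → I → Finset ℕ)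
    (n : ℕ) (p : I × F) (ω : Ω) : ℝ :=
  (1 / Real.sqrt n) *
    ∑ i ∈ Finset.range (intPart n p.1) \ D n p.1, ((p.2 : 𝓧 → ℝ) (ξ i ω) - ∫ y, (p.2 : 𝓧 → ℝ) y ∂P)

/-- `Z` is a Kiefer–Müller process on `[0, 1] × F` for the law `P`: a centred Gaussian process with
`cov (Z (s, f), Z (t, g)) = (s ∧ t) (P f g - P f P g)`. -/
structure IsKieferMullerProcess {Ω' 𝓧 : Type*} [MeasurableSpace Ω'] [MeasurableSpace 𝓧]
    (P : Measure 𝓧) (F : Set (𝓧 → ℝ)) (Z : I × F → Ω' → ℝ) (μ' : Measure Ω') : Prop where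
  isGaussianProcess : IsGaussianProcess Z μ'
  mean_zero : ∀ p : I × F, ∫ ω, Z p ω ∂μ' = 0
  covariance_eq : ∀ (s t : I) (f g : F),
    covariance (Z (s, f)) (Z (t, g)) μ' =
      min (s : ℝ) (t : ℝ) *
        (∫ y, (f : 𝓧 → ℝ) y * (g : 𝓧 → ℝ) y ∂P -
          (∫ y, (f : 𝓧 → ℝ) y ∂P) * ∫ y, (g : 𝓧 → ℝ) y ∂P)

open scoped Topology

/-! By Cramér–Wold it suffices to treat the characteristic function of one linear combination of the
marginals. Grouped by observation, it is `n^{-1/2}` times a sum of independent terms `g_A(ξ_i)`,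
where `A` is the set of coordinates whose index set contains `i`. Only finitely many `g_A` occur, so
a second-order Taylor comparison with Gaussians of equal variance is uniform in `i` and no Lindeberg
condition is needed (`tendsto_charFun_sum_array`). The Gaussian product depends on the index sets
only through the cardinalities of their pairwise intersections. Divided by `n`, these tend to `min x
y`, since only `o(n)` indices are deleted, whichever they are
(`IsDeletionScheme.tendsto_card_inter_div`). For existence, the covariance is the Gram kernel of the
vectors `1_{[0,s]} ⊗ (f - Pf)` in `L²([0,1] × 𝓧)`, on which an isonormal process is evaluated
(`exists_isonormal`). -/

lemma norm_prod_sub_prod_le_sum {ι R : Type*} [NormedCommRing R] [NormOneClass R]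
    (s : Finset ι) (z w : ι → R)
    (hz : ∀ i ∈ s, ‖z i‖ ≤ 1) (hw : ∀ i ∈ s, ‖w i‖ ≤ 1) :
    ‖∏ i ∈ s, z i - ∏ i ∈ s, w i‖ ≤ ∑ i ∈ s, ‖z i - w i‖ := by
  classical
  induction s using Finset.induction_on with
  | empty => simp
  | insert a s ha ih =>
    rw [Finset.prod_insert ha, Finset.prod_insert ha, Finset.sum_insert ha]
    have hz' : ∀ i ∈ s, ‖z i‖ ≤ 1 := fun i hi ↦ hz i (Finset.mem_insert_of_mem hi)
    have hw' : ∀ i ∈ s, ‖w i‖ ≤ 1 := fun i hi ↦ hw i (Finset.mem_insert_of_mem hi)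
    have hwa := hw a (Finset.mem_insert_self a s)
    have hprod : ‖∏ i ∈ s, z i‖ ≤ 1 :=
      (Finset.norm_prod_le s z).trans (Finset.prod_le_one (fun _ _ ↦ norm_nonneg _) hz')
    -- Telescoping: exchange one factor at a time, the remaining factors having norm at most one.
    calc ‖z a * ∏ i ∈ s, z i - w a * ∏ i ∈ s, w i‖
        = ‖(z a - w a) * ∏ i ∈ s, z i + w a * (∏ i ∈ s, z i - ∏ i ∈ s, w i)‖ := by
          congr 1; ring
      _ ≤ ‖z a - w a‖ * ‖∏ i ∈ s, z i‖ + ‖w a‖ * ‖∏ i ∈ s, z i - ∏ i ∈ s, w i‖ :=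
          (norm_add_le _ _).trans (add_le_add (norm_mul_le _ _) (norm_mul_le _ _))
      _ ≤ ‖z a - w a‖ * 1 + 1 * ∑ i ∈ s, ‖z i - w i‖ := by
          gcongr
          exact ih hz' hw'
      _ = _ := by ring

/-- Two laws on the line with the same mean and second moment have characteristic functions that
agree to second order at the origin. -/
lemma isLittleO_charFun_sub_charFun {ν ν' : Measure ℝ} [IsProbabilityMeasure ν]
    [IsProbabilityMeasure ν'] (h : MemLp id 2 ν) (h' : MemLp id 2 ν')
    (h1 : ∫ x, x ∂ν = ∫ x, x ∂ν') (h2 : ∫ x, x ^ 2 ∂ν = ∫ x, x ^ 2 ∂ν') :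
    (fun t ↦ charFun ν t - charFun ν' t) =o[𝓝 0] fun t ↦ t ^ 2 := by
  have key : ∀ {ρ : Measure ℝ} [IsProbabilityMeasure ρ], MemLp id 2 ρ →
      (fun t ↦ charFun ρ t - taylorWithinEval (charFun ρ) 2 Set.univ 0 t) =o[𝓝 0]
        fun t ↦ t ^ 2 := by
    intro ρ _ hρ
    have := taylor_isLittleO_univ (f := charFun ρ) (x₀ := 0) (n := 2)
      (contDiff_charFun (n := 2) (by exact_mod_cast hρ))
    simpa using this
  have heq : ∀ t, taylorWithinEval (charFun ν) 2 Set.univ 0 t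
      = taylorWithinEval (charFun ν') 2 Set.univ 0 t := by
    intro t
    rw [taylorWithinEval_charFun_zero (n := 2) (by exact_mod_cast h),
      taylorWithinEval_charFun_zero (n := 2) (by exact_mod_cast h')]
    simp [Finset.sum_range_succ, h1, h2]
  refine ((key h).sub (key h')).congr_left fun t ↦ ?_
  rw [heq t]; ring

/-- At `t = 1/√n` the `o(t²)` error is `o(1/n)`, so `n` such errors still add up to `o(1)`. -/
lemma tendsto_mul_norm_charFun_sub_charFun {ν ν' : Measure ℝ} [IsProbabilityMeasure ν]
    [IsProbabilityMeasure ν'] (h : MemLp id 2 ν) (h' : MemLp id 2 ν')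
    (h1 : ∫ x, x ∂ν = ∫ x, x ∂ν') (h2 : ∫ x, x ^ 2 ∂ν = ∫ x, x ^ 2 ∂ν') :
    Tendsto (fun n : ℕ ↦ (n : ℝ) * ‖charFun ν (√n)⁻¹ - charFun ν' (√n)⁻¹‖) atTop (𝓝 0) := by
  have hlim : Tendsto (fun n : ℕ ↦ (√(n : ℝ))⁻¹) atTop (𝓝 0) :=
    tendsto_inv_atTop_zero.comp (Real.tendsto_sqrt_atTop.comp tendsto_natCast_atTop_atTop)
  have := ((isLittleO_charFun_sub_charFun h h' h1 h2).comp_tendsto hlim).norm_left.tendsto_div_nhds_zero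
  refine this.congr fun n ↦ ?_
  simp [Real.sq_sqrt, div_eq_mul_inv, mul_comm]

/-! ### Central limit theorem for sums over varying index sets -/

section Array

variable {𝓧 Ω T : Type*} [MeasurableSpace 𝓧] [MeasurableSpace Ω] [Fintype T]
  {μ : Measure Ω} [IsProbabilityMeasure μ] {P : Measure 𝓧} [IsProbabilityMeasure P]
  {ξ : ℕ → Ω → 𝓧} {f : T → 𝓧 → ℝ} {B : ℕ → T → Finset ℕ}

omit [IsProbabilityMeasure μ] [IsProbabilityMeasure P] in
lemma charFun_map_inv_sqrt_mul_sum (hlaw : ∀ i, HasLaw (ξ i) P μ) (hindep : iIndepFun ξ μ)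
    {g : ℕ → 𝓧 → ℝ} (hg : ∀ i, Measurable (g i)) (n : ℕ) :
    charFun (μ.map fun ω ↦ (√n)⁻¹ * ∑ i ∈ Finset.range n, g i (ξ i ω)) 1
      = ∏ i ∈ Finset.range n, charFun (P.map (g i)) (√n)⁻¹ := by
  have hm : ∀ i, AEMeasurable (fun ω ↦ g i (ξ i ω)) μ := fun i ↦
    (hg i).comp_aemeasurable (hlaw i).aemeasurable
  have hind : iIndepFun (fun i ω ↦ g i (ξ i ω)) μ := hindep.comp g hg
  rw [charFun_map_mul_comp (Finset.aemeasurable_fun_sum _ fun i _ ↦ hm i), mul_one,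
    (hind.restrict _).charFun_map_fun_finsetSum_eq_prod fun i _ ↦ hm i, Finset.prod_apply]
  refine Finset.prod_congr rfl fun i _ ↦ ?_
  rw [← (hlaw i).map_eq, AEMeasurable.map_map_of_aemeasurable (hg i).aemeasurable
    (hlaw i).aemeasurable]
  rfl

omit [MeasurableSpace 𝓧] in
lemma sum_mul_inv_sqrt_mul_sum_eq [DecidableEq T] (hB : ∀ n p, B n p ⊆ Finset.range n) (c : T → ℝ) (n : ℕ)
    (x : ℕ → 𝓧) :
    ∑ p, c p * ((√n)⁻¹ * ∑ i ∈ B n p, f p (x i))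
      = (√n)⁻¹ * ∑ i ∈ Finset.range n, ∑ p with i ∈ B n p, c p * f p (x i) := by
  simp_rw [Finset.sum_filter]
  rw [Finset.sum_comm, Finset.mul_sum]
  refine Finset.sum_congr rfl fun p _ ↦ ?_
  rw [← Finset.sum_filter, Finset.filter_mem_eq_inter, Finset.inter_eq_right.2 (hB n p),
    ← Finset.mul_sum]
  ring

omit [Fintype T] [IsProbabilityMeasure P] in
lemma integral_sq_sum (hf2 : ∀ p, MemLp (f p) 2 P) (c : T → ℝ) (A : Finset T) :
    ∫ x, (∑ p ∈ A, c p * f p x) ^ 2 ∂P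
      = ∑ p ∈ A, ∑ q ∈ A, c p * c q * ∫ x, f p x * f q x ∂P := by
  have hint : ∀ p q, Integrable (fun x ↦ c p * c q * (f p x * f q x)) P := fun p q ↦
    ((hf2 p).integrable_mul (hf2 q)).const_mul _
  simp_rw [sq, Finset.sum_mul_sum]
  rw [integral_finsetSum _ fun p _ ↦ ?_]
  · refine Finset.sum_congr rfl fun p _ ↦ ?_
    rw [integral_finsetSum _ fun q _ ↦ ?_]
    · refine Finset.sum_congr rfl fun q _ ↦ ?_
      rw [← integral_const_mul]
      congr 1 with x
      ring
    · exact (hint p q).congr (ae_of_all _ fun x ↦ by ring)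
  · exact integrable_finsetSum _ fun q _ ↦ (hint p q).congr (ae_of_all _ fun x ↦ by ring)

omit [IsProbabilityMeasure μ] in
/-- Central limit theorem for partial sums over index sets `B n p ⊆ {0, …, n - 1}` with asymptotic
overlap proportions `a p q`, at the level of characteristic functions. -/
theorem tendsto_charFun_sum_array (hlaw : ∀ i, HasLaw (ξ i) P μ) (hindep : iIndepFun ξ μ)
    (hf : ∀ p, Measurable (f p)) (hf2 : ∀ p, MemLp (f p) 2 P) (hf0 : ∀ p, ∫ x, f p x ∂P = 0)
    (hB : ∀ n p, B n p ⊆ Finset.range n) {a : T → T → ℝ}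
    (ha : ∀ p q, Tendsto (fun n : ℕ ↦ ((B n p ∩ B n q).card : ℝ) / n) atTop (𝓝 (a p q)))
    (c : T → ℝ) :
    Tendsto (fun n : ℕ ↦
        charFun (μ.map fun ω ↦ ∑ p, c p * ((√n)⁻¹ * ∑ i ∈ B n p, f p (ξ i ω))) 1) atTop
      (𝓝 (Complex.exp (-((∑ p, ∑ q, c p * c q * (a p q * ∫ x, f p x * f q x ∂P) : ℝ) : ℂ) / 2))) := by
  classical
  -- The term carried by observation `i` depends on `n` and `i` only through the set `A n i` of
  -- coordinates using it. Since `g A` is centred, `v A` is its variance.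
  let g : Finset T → 𝓧 → ℝ := fun A x ↦ ∑ p ∈ A, c p * f p x
  let v : Finset T → NNReal := fun A ↦ (∫ x, g A x ^ 2 ∂P).toNNReal
  have hv : ∀ A, (v A : ℝ) = ∫ x, g A x ^ 2 ∂P := fun A ↦
    Real.coe_toNNReal _ (integral_nonneg fun x ↦ sq_nonneg _)
  let A : ℕ → ℕ → Finset T := fun n i ↦ Finset.univ.filter fun p ↦ i ∈ B n p
  have hg : ∀ A, Measurable (g A) := fun A ↦ by fun_prop
  have hg2 : ∀ A, MemLp (g A) 2 P := fun A ↦ memLp_finsetSum _ fun p _ ↦ (hf2 p).const_mul _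
  have hg0 : ∀ A, ∫ x, g A x ∂P = 0 := fun A ↦ by
    rw [integral_finsetSum _ fun p _ ↦ ((hf2 p).integrable (by norm_num)).const_mul _]
    simp [integral_const_mul, hf0]
  have : ∀ A, IsProbabilityMeasure (P.map (g A)) := fun A ↦
    Measure.isProbabilityMeasure_map (hg A).aemeasurable
  have hchar : ∀ n : ℕ,
      charFun (μ.map fun ω ↦ ∑ p, c p * ((√n)⁻¹ * ∑ i ∈ B n p, f p (ξ i ω))) 1
        = ∏ i ∈ Finset.range n, charFun (P.map (g (A n i))) (√n)⁻¹ := fun n ↦ by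
    rw [← charFun_map_inv_sqrt_mul_sum hlaw hindep fun i ↦ hg (A n i)]
    simp_rw [fun ω ↦ sum_mul_inv_sqrt_mul_sum_eq (f := f) hB c n fun i ↦ ξ i ω]
    rfl
  have hgauss : Tendsto (fun n : ℕ ↦
        ∏ i ∈ Finset.range n, charFun (gaussianReal 0 (v (A n i))) (√n)⁻¹) atTop
      (𝓝 (Complex.exp
        (-((∑ p, ∑ q, c p * c q * (a p q * ∫ x, f p x * f q x ∂P) : ℝ) : ℂ) / 2))) := by
    have hexp : ∀ n : ℕ, ∏ i ∈ Finset.range n, charFun (gaussianReal 0 (v (A n i))) (√n)⁻¹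
        = Complex.exp (-((∑ p, ∑ q, c p * c q * (((B n p ∩ B n q).card : ℝ) / n *
            ∫ x, f p x * f q x ∂P) : ℝ) : ℂ) / 2) := by
      intro n
      -- Double counting: the pair `(p, q)` contributes once for each `i` in `B n p ∩ B n q`.
      have hvar : ∑ i ∈ Finset.range n, (v (A n i) : ℝ)
          = ∑ p, ∑ q, c p * c q * ((B n p ∩ B n q).card * ∫ x, f p x * f q x ∂P) := by
        simp_rw [hv, g, integral_sq_sum hf2]
        calc ∑ i ∈ Finset.range n, ∑ p ∈ A n i, ∑ q ∈ A n i, c p * c q * ∫ x, f p x * f q x ∂P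
            = ∑ i ∈ Finset.range n, ∑ p, ∑ q,
                if i ∈ B n p ∩ B n q then c p * c q * ∫ x, f p x * f q x ∂P else 0 := by
              refine Finset.sum_congr rfl fun i _ ↦ ?_
              rw [Finset.sum_filter]
              refine Finset.sum_congr rfl fun p _ ↦ ?_
              by_cases hp : i ∈ B n p <;> simp [hp, A, Finset.sum_filter]
          _ = _ := by
              rw [Finset.sum_comm]
              refine Finset.sum_congr rfl fun p _ ↦ ?_
              rw [Finset.sum_comm]
              refine Finset.sum_congr rfl fun q _ ↦ ?_
              rw [Finset.sum_ite_mem, Finset.inter_eq_right.2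
                (Finset.inter_subset_left.trans (hB n p)), Finset.sum_const, nsmul_eq_mul]
              ring
      have hsq : ((√(n : ℝ) : ℂ)⁻¹) ^ 2 = (n : ℂ)⁻¹ := by
        rw [inv_pow, ← Complex.ofReal_pow, Real.sq_sqrt (Nat.cast_nonneg n), Complex.ofReal_natCast]
      simp_rw [charFun_gaussianReal, ← Complex.exp_sum]
      congr 1
      have : ∑ p, ∑ q, c p * c q * (((B n p ∩ B n q).card : ℝ) / n * ∫ x, f p x * f q x ∂P)
          = (∑ i ∈ Finset.range n, (v (A n i) : ℝ)) / n := by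
        rw [hvar, Finset.sum_div]
        refine Finset.sum_congr rfl fun p _ ↦ ?_
        rw [Finset.sum_div]
        exact Finset.sum_congr rfl fun q _ ↦ by ring
      rw [this]
      push_cast
      rw [Finset.sum_div, ← Finset.sum_neg_distrib, Finset.sum_div]
      refine Finset.sum_congr rfl fun i _ ↦ ?_
      rw [hsq]
      ring
    simp_rw [hexp]
    refine (Complex.continuous_exp.tendsto _).comp (Tendsto.div_const (Tendsto.neg
      ((Complex.continuous_ofReal.tendsto _).comp ?_)) _)
    exact tendsto_finsetSum _ fun p _ ↦ tendsto_finsetSum _ fun q _ ↦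
      ((ha p q).mul_const _).const_mul _
  have hdiff : Tendsto (fun n : ℕ ↦ ∏ i ∈ Finset.range n, charFun (P.map (g (A n i))) (√n)⁻¹
      - ∏ i ∈ Finset.range n, charFun (gaussianReal 0 (v (A n i))) (√n)⁻¹) atTop (𝓝 0) := by
    -- Summing over all subsets `S` bounds the error of every factor independently of `i`; the
    -- factor `n` counts the observations.
    have hsum : Tendsto (fun n : ℕ ↦ ∑ S : Finset T,
        (n : ℝ) * ‖charFun (P.map (g S)) (√n)⁻¹ - charFun (gaussianReal 0 (v S)) (√n)⁻¹‖)
        atTop (𝓝 0) := by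
      rw [← Finset.sum_const_zero (s := (Finset.univ : Finset (Finset T)))]
      refine tendsto_finsetSum _ fun S _ ↦ tendsto_mul_norm_charFun_sub_charFun ?_
        (memLp_id_gaussianReal 2) ?_ ?_
      · exact (memLp_map_measure_iff (by fun_prop) (hg S).aemeasurable).2 (hg2 S)
      · rw [integral_map (hg S).aemeasurable (by fun_prop), hg0]
        simp
      · rw [integral_map (hg S).aemeasurable (by fun_prop), ← hv]
        have := variance_id_gaussianReal (μ := 0) (v := v S)
        rw [variance_of_integral_eq_zero (by fun_prop) (by simp)] at this
        simpa using this.symm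
    refine squeeze_zero_norm (fun n ↦ ?_) hsum
    refine (norm_prod_sub_prod_le_sum _ _ _ (fun _ _ ↦ norm_charFun_le_one _)
      (fun _ _ ↦ norm_charFun_le_one _)).trans ?_
    calc _ ≤ ∑ i ∈ Finset.range n, ∑ S : Finset T,
          ‖charFun (P.map (g S)) (√n)⁻¹ - charFun (gaussianReal 0 (v S)) (√n)⁻¹‖ :=
          Finset.sum_le_sum fun i _ ↦ Finset.single_le_sum
            (f := fun S ↦ ‖charFun (P.map (g S)) (√n)⁻¹ - charFun (gaussianReal 0 (v S)) (√n)⁻¹‖)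
            (fun S _ ↦ norm_nonneg _) (Finset.mem_univ (A n i))
      _ = _ := by rw [Finset.sum_const, Finset.card_range, nsmul_eq_mul, Finset.mul_sum]
  simp_rw [hchar]
  simpa using hdiff.add hgauss

end Array

/-! ### Isonormal Gaussian processes -/

section Isonormal

variable {Ω : Type*} [MeasurableSpace Ω] {ν : Measure Ω} [IsProbabilityMeasure ν]

lemma charFun_map_of_tendsto_Lp {X : ℕ → Lp ℝ 2 ν} {Y : Lp ℝ 2 ν} (h : Tendsto X atTop (𝓝 Y))
    (t : ℝ) : Tendsto (fun n ↦ charFun (ν.map (X n)) t) atTop (𝓝 (charFun (ν.map Y) t)) := by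
  have hm : ∀ n, AEMeasurable (X n) ν := fun n ↦ (Lp.aestronglyMeasurable (X n)).aemeasurable
  exact ProbabilityMeasure.tendsto_iff_tendsto_charFun.1
    ((tendstoInMeasure_of_tendsto_Lp h).tendstoInDistribution hm).tendsto t

/-- The Gaussian characteristic function is continuous in the norm, and `L²` convergence implies
convergence in law. This carries Gaussianity from finite sums to Hilbert basis expansions. -/
lemma isClosed_setOf_map_eq_gaussianReal :
    IsClosed {X : Lp ℝ 2 ν | ν.map X = gaussianReal 0 (‖X‖₊ ^ 2)} := by
  refine IsSeqClosed.isClosed fun X Y hX hXY ↦ ?_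
  have hYm : AEMeasurable Y ν := (Lp.aestronglyMeasurable Y).aemeasurable
  have := Measure.isProbabilityMeasure_map hYm
  refine Measure.ext_of_charFun (funext fun t ↦ ?_)
  refine tendsto_nhds_unique (charFun_map_of_tendsto_Lp hXY t) ?_
  simp_rw [fun n ↦ show ν.map (X n) = gaussianReal 0 (‖X n‖₊ ^ 2) from hX n, charFun_gaussianReal]
  push_cast
  have hn : Tendsto (fun n ↦ ((‖X n‖ : ℝ) : ℂ)) atTop (𝓝 ((‖Y‖ : ℝ) : ℂ)) :=
    (Complex.continuous_ofReal.tendsto _).comp hXY.norm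
  exact (Complex.continuous_exp.tendsto _).comp
    (((((hn.pow 2).mul_const _).div_const _)).const_sub _)

omit [IsProbabilityMeasure ν] in
lemma Lp_coeFn_sum_smul {ι : Type*} (e : ι → Lp ℝ 2 ν) (s : Finset ι) (c : ι → ℝ) :
    (∑ i ∈ s, c i • e i : Lp ℝ 2 ν) =ᵐ[ν] fun ω ↦ ∑ i ∈ s, c i * e i ω := by
  classical
  induction s using Finset.induction_on with
  | empty => exact Lp.coeFn_zero ℝ 2 ν
  | insert a s ha ih =>
    rw [Finset.sum_insert ha]
    filter_upwards [ih, Lp.coeFn_add (c a • e a) (∑ i ∈ s, c i • e i),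
      Lp.coeFn_smul (c a) (e a)] with ω h1 h2 h3
    rw [h2, Pi.add_apply, h1, h3, Finset.sum_insert ha, Pi.smul_apply, smul_eq_mul]

/-- A finite linear combination of independent standard Gaussian variables. -/
lemma map_sum_smul_eq_gaussianReal {ι : Type*} {e : ι → Lp ℝ 2 ν}
    (hlaw : ∀ i, ν.map (e i) = gaussianReal 0 1) (hindep : iIndepFun (fun i ↦ ⇑(e i)) ν)
    (ho : Orthonormal ℝ e) (s : Finset ι) (c : ι → ℝ) :
    ν.map (∑ i ∈ s, c i • e i : Lp ℝ 2 ν) = gaussianReal 0 (‖∑ i ∈ s, c i • e i‖₊ ^ 2) := by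
  have hm : ∀ i, AEMeasurable (e i) ν := fun i ↦ (Lp.aestronglyMeasurable (e i)).aemeasurable
  have hae := Lp_coeFn_sum_smul e s c
  have hnorm : ‖∑ i ∈ s, c i • e i‖ ^ 2 = ∑ i ∈ s, c i ^ 2 := by
    rw [← real_inner_self_eq_norm_sq, ho.inner_sum]
    simp [sq]
  have hsm : AEMeasurable (fun ω ↦ ∑ i ∈ s, c i * e i ω) ν :=
    Finset.aemeasurable_fun_sum _ fun i _ ↦ (hm i).const_mul _
  have := Measure.isProbabilityMeasure_map hsm
  rw [Measure.map_congr hae]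
  refine Measure.ext_of_charFun (funext fun t ↦ ?_)
  have hind : iIndepFun (fun i ω ↦ c i * e i ω) ν :=
    hindep.comp (fun i x ↦ c i * x) fun i ↦ measurable_const_mul _
  rw [(hind.restrict _).charFun_map_fun_finsetSum_eq_prod fun i _ ↦ (hm i).const_mul _,
    Finset.prod_apply, charFun_gaussianReal]
  simp_rw [fun i ↦ charFun_map_mul_comp (hm i) (c i) t, hlaw, charFun_gaussianReal,
    ← Complex.exp_sum]
  congr 1
  push_cast
  rw [← Complex.ofReal_pow (‖_‖), hnorm]
  push_cast
  rw [Finset.sum_mul, Finset.sum_div, mul_zero, zero_mul, zero_sub, ← Finset.sum_neg_distrib]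
  refine Finset.sum_congr rfl fun i _ ↦ ?_
  ring

/-- Every real Hilbert space embeds isometrically into a space of centred Gaussian variables. -/
theorem exists_isonormal (H : Type u) [NormedAddCommGroup H] [InnerProductSpace ℝ H]
    [CompleteSpace H] :
    ∃ (Ω' : Type u) (_ : MeasurableSpace Ω') (ν : Measure Ω') (_ : IsProbabilityMeasure ν)
      (W : H →ₗᵢ[ℝ] Lp ℝ 2 ν), ∀ h, ν.map (W h) = gaussianReal 0 (‖h‖₊ ^ 2) := by
  -- One independent standard Gaussian coordinate per basis vector; `w` may be uncountable. The
  -- isometry sends basis vectors to coordinates.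
  obtain ⟨w, b, -⟩ := exists_hilbertBasis ℝ H
  let ν : Measure (w → ℝ) := Measure.infinitePi fun _ ↦ gaussianReal 0 1
  have hmap : ∀ i, ν.map (fun ω ↦ ω i) = gaussianReal 0 1 := fun i ↦
    Measure.infinitePi_map_eval _ i
  have hev : ∀ i : w, AEMeasurable (fun ω : w → ℝ ↦ ω i) ν := fun i ↦
    (measurable_pi_apply i).aemeasurable
  have hind : iIndepFun (fun (i : w) (ω : w → ℝ) ↦ ω i) ν :=
    iIndepFun_infinitePi (X := fun _ x ↦ x) fun _ ↦ measurable_id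
  have hmem : ∀ i, MemLp (fun ω : w → ℝ ↦ ω i) 2 ν := fun i ↦ by
    have : MemLp id 2 (ν.map fun ω ↦ ω i) := by rw [hmap]; exact memLp_id_gaussianReal 2
    exact (memLp_map_measure_iff (by fun_prop) (hev i)).1 this
  let e : w → Lp ℝ 2 ν := fun i ↦ (hmem i).toLp
  have he : ∀ i, e i =ᵐ[ν] fun ω ↦ ω i := fun i ↦ (hmem i).coeFn_toLp
  have hlaw : ∀ i, ν.map (e i) = gaussianReal 0 1 := fun i ↦ by
    rw [Measure.map_congr (he i), hmap]
  have hindep : iIndepFun (fun i ↦ ⇑(e i)) ν := hind.congr fun i ↦ (he i).symm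
  have hmean : ∀ i, ∫ ω : w → ℝ, ω i ∂ν = 0 := fun i ↦ by
    have := integral_map (μ := ν) (φ := fun ω ↦ ω i) (f := fun x : ℝ ↦ x) (hev i)
      (by fun_prop)
    rw [← this, hmap]
    simp
  have ho : Orthonormal ℝ e := by
    classical
    rw [orthonormal_iff_ite]
    intro i j
    rw [L2.inner_def]
    have : ∫ ω, inner ℝ (e i ω) (e j ω) ∂ν = ∫ ω : w → ℝ, ω i * ω j ∂ν := by
      refine integral_congr_ae ?_
      filter_upwards [he i, he j] with ω h1 h2
      rw [h1, h2]
      simp [mul_comm]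
    rw [this]
    split_ifs with h
    · subst h
      have h1 := integral_map (μ := ν) (φ := fun ω ↦ ω i) (f := fun x : ℝ ↦ x * x) (hev i)
        (by fun_prop)
      rw [← h1, hmap]
      have h2 := variance_id_gaussianReal (μ := 0) (v := 1)
      rw [variance_of_integral_eq_zero (by fun_prop) (by simp)] at h2
      simpa [sq] using h2
    · have := (hind.indepFun h).integral_mul_eq_mul_integral
        (hmem i).aestronglyMeasurable (hmem j).aestronglyMeasurable
      simpa [hmean] using this
  refine ⟨w → ℝ, inferInstance, ν, inferInstance,
    ho.orthogonalFamily.linearIsometry.comp b.repr.toLinearIsometry, fun h ↦ ?_⟩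
  have hnorm : ‖h‖₊ = ‖ho.orthogonalFamily.linearIsometry (b.repr h)‖₊ := by
    ext; simp
  have hs := ho.orthogonalFamily.hasSum_linearIsometry (b.repr h)
  rw [hnorm]
  refine isClosed_setOf_map_eq_gaussianReal.mem_of_tendsto hs (Eventually.of_forall fun s ↦ ?_)
  simpa using map_sum_smul_eq_gaussianReal hlaw hindep ho s fun i ↦ b.repr h i

/-- A Gaussian process whose covariance is the Gram kernel of a family of vectors. -/
theorem exists_isGaussianProcess_inner {T : Type*} {H : Type u} [NormedAddCommGroup H]
    [InnerProductSpace ℝ H] [CompleteSpace H] (v : T → H) :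
    ∃ (Ω' : Type u) (_ : MeasurableSpace Ω') (ν : Measure Ω') (Z : T → Ω' → ℝ),
      IsProbabilityMeasure ν ∧ IsGaussianProcess Z ν ∧ (∀ t, ∫ ω, Z t ω ∂ν = 0) ∧
        ∀ s t, cov[Z s, Z t; ν] = inner ℝ (v s) (v t) := by
  obtain ⟨Ω', _, ν, hν, W, hW⟩ := exists_isonormal H
  have hm : ∀ h, AEMeasurable (W h) ν := fun h ↦ (Lp.aestronglyMeasurable (W h)).aemeasurable
  have hmean : ∀ h, ∫ ω, W h ω ∂ν = 0 := fun h ↦ by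
    have := integral_map (hm h) (f := fun x : ℝ ↦ x) (by fun_prop)
    rw [← this, hW]
    simp
  refine ⟨Ω', _, ν, fun t ↦ W (v t), hν, ⟨fun S ↦ ⟨?_⟩⟩, fun t ↦ hmean (v t), fun s t ↦ ?_⟩
  · have hS : AEMeasurable (fun ω ↦ S.restrict fun t ↦ W (v t) ω) ν :=
      aemeasurable_pi_lambda _ fun t ↦ hm _
    refine isGaussian_of_isGaussian_map fun L ↦ ?_
    rw [AEMeasurable.map_map_of_aemeasurable (by fun_prop) hS]
    classical
    -- By linearity of `W`, any functional of the finite vector is a.e. a single `W h`, whose law is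
    -- Gaussian.
    have hae : (L ∘ fun ω ↦ S.restrict fun t ↦ W (v t) ω)
        =ᵐ[ν] W (∑ t : S, L (Pi.single t 1) • v t) := by
      have hLp := Lp_coeFn_sum_smul (fun t : S ↦ W (v t)) Finset.univ fun t ↦ L (Pi.single t 1)
      simp_rw [map_sum, map_smul]
      filter_upwards [hLp] with ω h1
      rw [h1, Function.comp_apply]
      conv_lhs => rw [pi_eq_sum_univ' (S.restrict fun t ↦ W (v t) ω)]
      rw [map_sum]
      refine Finset.sum_congr rfl fun t _ ↦ ?_
      rw [map_smul, smul_eq_mul, mul_comm]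
      rfl
    rw [Measure.map_congr hae, hW]
    infer_instance
  · rw [covariance, hmean, hmean, ← W.inner_map_map, L2.inner_def]
    simp [mul_comm]

end Isonormal

/-! ### Existence of the Kiefer–Müller process -/

section KieferMuller

variable {𝓧 : Type u} [MeasurableSpace 𝓧] (P : Measure 𝓧) [IsProbabilityMeasure P]

omit [IsProbabilityMeasure P] in
lemma memLp_indicator_mul_prod {f : 𝓧 → ℝ} (hf : MemLp f 2 P) (s : I) :
    MemLp (fun z : I × 𝓧 ↦ (Set.Iic s).indicator (fun _ ↦ (1 : ℝ)) z.1 * f z.2) 2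
      ((volume : Measure I).prod P) := by
  have hs : AEStronglyMeasurable ((Set.Iic s).indicator fun _ ↦ (1 : ℝ)) (volume : Measure I) :=
    aestronglyMeasurable_const.indicator measurableSet_Iic
  refine (memLp_two_iff_integrable_sq (hs.comp_fst.mul hf.1.comp_snd)).2 ?_
  refine (((integrable_const (1 : ℝ)).indicator (measurableSet_Iic (a := s))).mul_prod
    hf.integrable_sq).congr (ae_of_all _ fun z ↦ ?_)
  by_cases h : z.1 ∈ Set.Iic s <;> simp [h]

lemma integral_indicator_mul_indicator (s t : I) :
    ∫ x : I, (Set.Iic s).indicator (fun _ ↦ (1 : ℝ)) x * (Set.Iic t).indicator (fun _ ↦ 1) x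
      = min (s : ℝ) (t : ℝ) := by
  have h : ∀ x : I, (Set.Iic s).indicator (fun _ ↦ (1 : ℝ)) x * (Set.Iic t).indicator (fun _ ↦ 1) x
      = (Set.Iic (min s t)).indicator 1 x := fun x ↦ by
    simp only [Set.indicator_apply, Set.mem_Iic, le_min_iff, Pi.one_apply]
    split_ifs <;> simp_all
  simp_rw [h]
  rw [integral_indicator_one measurableSet_Iic, measureReal_def, unitInterval.volume_Iic,
    ENNReal.toReal_ofReal (min s t).2.1]
  exact (Subtype.mono_coe _).map_min

/-- By Fubini the inner product of the product vectors splits into a time factor `min s t` and the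
covariance of `f` and `g` under `P`. -/
theorem exists_isKieferMullerProcess (F : Set (𝓧 → ℝ)) (hF : ∀ f ∈ F, MemLp f 2 P) :
    ∃ (Ω' : Type u) (_ : MeasurableSpace Ω') (μ' : Measure Ω') (Z : I × F → Ω' → ℝ),
      IsProbabilityMeasure μ' ∧ IsKieferMullerProcess P F Z μ' := by
  have hc : ∀ f : F, MemLp (fun y ↦ (f : 𝓧 → ℝ) y - ∫ x, (f : 𝓧 → ℝ) x ∂P) 2 P := fun f ↦
    (hF f f.2).sub (memLp_const _)
  obtain ⟨Ω', _, μ', Z, hμ', hZ, h0, hcov⟩ := exists_isGaussianProcess_inner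
    fun p : I × F ↦ (memLp_indicator_mul_prod P (hc p.2) p.1).toLp
  refine ⟨Ω', _, μ', Z, hμ', hZ, h0, fun s t f g ↦ ?_⟩
  rw [hcov, L2.inner_def]
  have h1 : cov[(f : 𝓧 → ℝ), (g : 𝓧 → ℝ); P] = _ := covariance_eq_sub (hF f f.2) (hF g g.2)
  simp only [Pi.mul_apply] at h1
  rw [← h1, ← integral_indicator_mul_indicator, covariance, ← integral_prod_mul]
  refine integral_congr_ae ?_
  filter_upwards [(memLp_indicator_mul_prod P (hc f) s).coeFn_toLp,
    (memLp_indicator_mul_prod P (hc g) t).coeFn_toLp] with z hz1 hz2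
  rw [hz1, hz2]
  simp only [RCLike.inner_apply, conj_trivial]
  ring

end KieferMuller

/-! ### Asymptotic sizes of the retained index sets -/

lemma intPart_le (n : ℕ) (x : I) : intPart n x ≤ n :=
  Nat.floor_le_of_le (mul_le_of_le_one_right n.cast_nonneg x.2.2)

lemma tendsto_intPart_div (x : I) :
    Tendsto (fun n : ℕ ↦ (intPart n x : ℝ) / n) atTop (𝓝 x) := by
  have := (tendsto_nat_floor_mul_div_atTop (R := ℝ) x.2.1).comp tendsto_natCast_atTop_atTop
  refine this.congr fun n ↦ ?_
  simp [intPart, mul_comm]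

lemma tendsto_intPart_atTop {x : I} (hx : 0 < (x : ℝ)) :
    Tendsto (fun n : ℕ ↦ intPart n x) atTop atTop :=
  tendsto_nat_floor_atTop.comp (tendsto_natCast_atTop_atTop.atTop_mul_const hx)

lemma IsDeletionScheme.tendsto_card_div {k : ℕ → ℕ} {D : ℕ → I → Finset ℕ}
    (hD : IsDeletionScheme k D) (hk : Tendsto (fun n : ℕ ↦ (k n : ℝ) / (n : ℝ)) atTop (𝓝 0))
    (x : I) : Tendsto (fun n : ℕ ↦ ((D n x).card : ℝ) / n) atTop (𝓝 0) := by
  -- At `x = 0` the integer part stays at `0`, so the hypothesis on `k` gives nothing; but then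
  -- nothing can be deleted.
  rcases x.2.1.eq_or_lt with hx | hx
  · have h0 : ∀ n, (D n x).card = 0 := fun n ↦ by
      rw [(hD n x).2]; simp [intPart, ← hx]
    simp [h0]
  · have hlim := (hk.comp (tendsto_intPart_atTop hx)).mul (tendsto_intPart_div x)
    rw [zero_mul] at hlim
    refine squeeze_zero (fun n ↦ by positivity) (fun n ↦ ?_) hlim
    rw [(hD n x).2, Function.comp_apply]
    rcases eq_or_ne (intPart n x) 0 with h | h
    · simp [h]
    · rw [div_mul_div_cancel₀ (by exact_mod_cast h)]
      gcongr
      exact min_le_left _ _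

/-- Each of the first `min [nx] [ny]` indices is either retained by both sets or lies in `D n x` or
`D n y`, which squeezes the count. -/
lemma IsDeletionScheme.tendsto_card_inter_div {k : ℕ → ℕ} {D : ℕ → I → Finset ℕ}
    (hD : IsDeletionScheme k D) (hk : Tendsto (fun n : ℕ ↦ (k n : ℝ) / (n : ℝ)) atTop (𝓝 0))
    (x y : I) :
    Tendsto (fun n : ℕ ↦ (((Finset.range (intPart n x) \ D n x) ∩
      (Finset.range (intPart n y) \ D n y)).card : ℝ) / n) atTop (𝓝 (min (x : ℝ) (y : ℝ))) := by
  have hmin := (tendsto_intPart_div x).min (tendsto_intPart_div y)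
  have hlow := (hmin.sub (hD.tendsto_card_div hk x)).sub (hD.tendsto_card_div hk y)
  rw [sub_zero, sub_zero] at hlow
  refine tendsto_of_tendsto_of_tendsto_of_le_of_le hlow hmin (fun n ↦ ?_) (fun n ↦ ?_)
  · have h : min (intPart n x) (intPart n y) ≤ ((Finset.range (intPart n x) \ D n x) ∩
        (Finset.range (intPart n y) \ D n y)).card + (D n x).card + (D n y).card := by
      rw [← Finset.card_range (min (intPart n x) (intPart n y))]
      refine (Finset.card_le_card fun i hi ↦ ?_).trans ((Finset.card_union_le _ (D n y)).trans
        (Nat.add_le_add_right (Finset.card_union_le _ (D n x)) _))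
      simp only [Finset.mem_range, lt_min_iff] at hi
      simp only [Finset.mem_union, Finset.mem_inter, Finset.mem_sdiff, Finset.mem_range]
      tauto
    have h' : (min (intPart n x : ℝ) (intPart n y)) ≤ (((Finset.range (intPart n x) \ D n x) ∩
        (Finset.range (intPart n y) \ D n y)).card : ℝ) + (D n x).card + (D n y).card := by
      exact_mod_cast h
    rw [min_div_div_right n.cast_nonneg, ← sub_div, ← sub_div]
    gcongr
    linarith
  · have h : ((Finset.range (intPart n x) \ D n x) ∩
        (Finset.range (intPart n y) \ D n y)).card ≤ min (intPart n x) (intPart n y) := by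
      rw [← Finset.card_range (min (intPart n x) (intPart n y))]
      refine Finset.card_le_card fun i hi ↦ ?_
      simp only [Finset.mem_inter, Finset.mem_sdiff, Finset.mem_range] at hi
      simp [hi.1.1, hi.2.1]
    rw [min_div_div_right n.cast_nonneg]
    gcongr
    exact le_min (Nat.cast_le.2 (h.trans (min_le_left _ _)))
      (Nat.cast_le.2 (h.trans (min_le_right _ _)))

/-! ### Convergence of the finite-dimensional marginals -/

lemma charFun_map_toLp_eq {Ω ι : Type*} [MeasurableSpace Ω] [Fintype ι] {μ : Measure Ω}
    {Y : ι → Ω → ℝ} (hY : ∀ p, AEMeasurable (Y p) μ) (c : EuclideanSpace ℝ ι) :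
    charFun (μ.map fun ω ↦ WithLp.toLp 2 fun p ↦ Y p ω) c
      = charFun (μ.map fun ω ↦ ∑ p, c p * Y p ω) 1 := by
  have hY' : AEMeasurable (fun ω ↦ WithLp.toLp 2 fun p ↦ Y p ω : Ω → EuclideanSpace ℝ ι) μ :=
    (WithLp.measurable_toLp 2 _).comp_aemeasurable (aemeasurable_pi_lambda _ hY)
  rw [charFun_apply, charFun_apply_real, integral_map hY' (by fun_prop),
    integral_map (Finset.aemeasurable_fun_sum _ fun p _ ↦ (hY p).const_mul _) (by fun_prop)]
  simp [PiLp.inner_apply]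

/-- The combination is centred Gaussian, so its variance decides. Covariances are written with
centred functions to match the limit in `tendsto_charFun_sum_array`. -/
lemma IsKieferMullerProcess.charFun_sum {Ω' 𝓧 : Type*} [MeasurableSpace Ω'] [MeasurableSpace 𝓧]
    {P : Measure 𝓧} [IsProbabilityMeasure P] {F : Set (𝓧 → ℝ)} (hF : ∀ f ∈ F, MemLp f 2 P)
    {Z : I × F → Ω' → ℝ} {μ' : Measure Ω'} (hZ : IsKieferMullerProcess P F Z μ')
    (S : Finset (I × F)) (c : S → ℝ) :
    charFun (μ'.map fun ω ↦ ∑ p : S, c p * Z p ω) 1 =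
      Complex.exp (-((∑ p : S, ∑ q : S, c p * c q * (min (p.1.1 : ℝ) (q.1.1 : ℝ) *
        ∫ x, ((p.1.2 : 𝓧 → ℝ) x - ∫ y, (p.1.2 : 𝓧 → ℝ) y ∂P) *
          ((q.1.2 : 𝓧 → ℝ) x - ∫ y, (q.1.2 : 𝓧 → ℝ) y ∂P) ∂P) : ℝ) : ℂ) / 2) := by
  have := hZ.isGaussianProcess.isProbabilityMeasure
  have hgauss : IsGaussianProcess (fun (p : S) ω ↦ c p * Z p ω) μ' :=
    (hZ.isGaussianProcess.comp_right (fun p : S ↦ (p : I × F))).smul c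
  have hL2 : ∀ p : S, MemLp (fun ω ↦ c p * Z p ω) 2 μ' := fun p ↦
    (hgauss.hasGaussianLaw_eval p).memLp_two
  have hsum : HasGaussianLaw (fun ω ↦ ∑ p : S, c p * Z p ω) μ' := hgauss.hasGaussianLaw_fun_sum
  rw [hsum.charFun_map_eq]
  have hinner : ∀ x : ℝ, inner ℝ (1 : ℝ) x = x := by simp
  have hmean : ∫ ω, inner ℝ 1 (∑ p : S, c p * Z p ω) ∂μ' = 0 := by
    simp only [hinner]
    rw [integral_finsetSum _ fun p _ ↦ (hL2 p).integrable (by norm_num)]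
    simp [integral_const_mul, hZ.mean_zero]
  have hvar : Var[fun ω ↦ inner ℝ 1 (∑ p : S, c p * Z p ω); μ'] =
      ∑ p : S, ∑ q : S, c p * c q * (min (p.1.1 : ℝ) (q.1.1 : ℝ) *
        ∫ x, ((p.1.2 : 𝓧 → ℝ) x - ∫ y, (p.1.2 : 𝓧 → ℝ) y ∂P) *
          ((q.1.2 : 𝓧 → ℝ) x - ∫ y, (q.1.2 : 𝓧 → ℝ) y ∂P) ∂P) := by
    simp only [hinner]
    rw [variance_fun_sum hL2]
    refine Finset.sum_congr rfl fun p _ ↦ Finset.sum_congr rfl fun q _ ↦ ?_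
    rw [covariance_const_mul_left, covariance_const_mul_right]
    have h1 := hZ.covariance_eq p.1.1 q.1.1 p.1.2 q.1.2
    have h2 : cov[(p.1.2 : 𝓧 → ℝ), (q.1.2 : 𝓧 → ℝ); P] = _ :=
      covariance_eq_sub (hF _ p.1.2.2) (hF _ q.1.2.2)
    simp only [Pi.mul_apply] at h2
    rw [← h2] at h1
    change c p * (c q * cov[Z (p.1.1, p.1.2), Z (q.1.1, q.1.2); μ']) = _
    rw [h1, covariance, mul_assoc]
  rw [hmean, hvar]
  simp [neg_div]

theorem IsKieferMullerProcess.tendstoInDistribution {𝓧 Ω Ω' : Type*} [MeasurableSpace 𝓧]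
    [MeasurableSpace Ω] [MeasurableSpace Ω'] {μ : Measure Ω} [IsProbabilityMeasure μ]
    {P : Measure 𝓧} [IsProbabilityMeasure P] {ξ : ℕ → Ω → 𝓧} (hlaw : ∀ i, HasLaw (ξ i) P μ)
    (hindep : iIndepFun ξ μ) {F : Set (𝓧 → ℝ)} (hF : ∀ f ∈ F, Measurable f ∧ MemLp f 2 P)
    {k : ℕ → ℕ} (hk : Tendsto (fun n : ℕ ↦ (k n : ℝ) / (n : ℝ)) atTop (𝓝 0))
    {D : ℕ → I → Finset ℕ} (hD : IsDeletionScheme k D) {μ' : Measure Ω'} [IsProbabilityMeasure μ']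
    {Z : I × F → Ω' → ℝ} (hZ : IsKieferMullerProcess P F Z μ') (S : Finset (I × F)) :
    TendstoInDistribution
      (fun (n : ℕ) (ω : Ω) ↦ S.restrict (fun p ↦ deletingEmpiricalProcess P F ξ D n p ω))
      atTop (fun ω' : Ω' ↦ S.restrict (fun p ↦ Z p ω')) (fun _ ↦ μ) μ' := by
  have hmeas : ∀ n p, AEMeasurable (deletingEmpiricalProcess P F ξ D n p) μ := fun n p ↦
    (Finset.aemeasurable_fun_sum _ fun i _ ↦ (((hF _ p.2.2).1.comp_aemeasurable
      (hlaw i).aemeasurable).sub_const _)).const_mul _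
  have hZm : ∀ p, AEMeasurable (Z p) μ' := hZ.isGaussianProcess.aemeasurable
  -- Characteristic functions need an inner product, hence the detour through `EuclideanSpace`; the
  -- continuous map `WithLp.ofLp` leads back.
  have key : TendstoInDistribution
      (fun (n : ℕ) (ω : Ω) ↦ (WithLp.toLp 2 fun p : S ↦ deletingEmpiricalProcess P F ξ D n p ω :
        EuclideanSpace ℝ S))
      atTop (fun ω' : Ω' ↦ WithLp.toLp 2 fun p : S ↦ Z p ω') (fun _ ↦ μ) μ' := by
    refine ⟨fun n ↦ (WithLp.measurable_toLp 2 _).comp_aemeasurable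
      (aemeasurable_pi_lambda _ fun p ↦ hmeas n p), (WithLp.measurable_toLp 2 _).comp_aemeasurable
      (aemeasurable_pi_lambda _ fun p ↦ hZm p), ?_⟩
    refine ProbabilityMeasure.tendsto_iff_tendsto_charFun.2 fun c ↦ ?_
    simp only [ProbabilityMeasure.coe_mk]
    rw [charFun_map_toLp_eq (fun p : S ↦ hZm p), hZ.charFun_sum (fun f hf ↦ (hF f hf).2) S c]
    refine (tendsto_charFun_sum_array hlaw hindep
      (f := fun (p : S) x ↦ (p.1.2 : 𝓧 → ℝ) x - ∫ y, (p.1.2 : 𝓧 → ℝ) y ∂P)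
      (B := fun n p ↦ Finset.range (intPart n p.1.1) \ D n p.1.1)
      (fun p ↦ (hF _ p.1.2.2).1.sub_const _)
      (fun p ↦ (hF _ p.1.2.2).2.sub (memLp_const _))
      (fun p ↦ ?_) (fun n p ↦ Finset.sdiff_subset.trans
        (Finset.range_subset_range.2 (intPart_le n _)))
      (fun p q ↦ hD.tendsto_card_inter_div hk p.1.1 q.1.1) c).congr fun n ↦ ?_
    · rw [integral_sub ((hF _ p.1.2.2).2.integrable (by norm_num)) (integrable_const _)]
      simp
    · rw [charFun_map_toLp_eq (fun p : S ↦ hmeas n p)]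
      simp [deletingEmpiricalProcess]
  exact key.continuous_comp (g := WithLp.ofLp) (PiLp.continuous_ofLp 2 _)

theorem theorem6 {𝓧 : Type u} {Ω : Type v} [MeasurableSpace 𝓧] [MeasurableSpace Ω]
    (μ : Measure Ω) [IsProbabilityMeasure μ] (P : Measure 𝓧) [IsProbabilityMeasure P]
    (ξ : ℕ → Ω → 𝓧) (hlaw : ∀ i, HasLaw (ξ i) P μ) (hindep : iIndepFun ξ μ)
    (F : Set (𝓧 → ℝ)) (hF : ∀ f ∈ F, Measurable f ∧ MemLp f 2 P)
    (k : ℕ → ℕ) (hk : Tendsto (fun n : ℕ => (k n : ℝ) / (n : ℝ)) atTop (nhds 0))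
    (D : ℕ → I → Finset ℕ) (hD : IsDeletionScheme k D) :
    (∃ (Ω' : Type u) (_ : MeasurableSpace Ω') (μ' : Measure Ω') (Z : I × F → Ω' → ℝ),
      IsProbabilityMeasure μ' ∧ IsKieferMullerProcess P F Z μ') ∧
    ∀ (Ω' : Type w) [MeasurableSpace Ω'] (μ' : Measure Ω') [IsProbabilityMeasure μ']
      (Z : I × F → Ω' → ℝ), IsKieferMullerProcess P F Z μ' →
      ∀ S : Finset (I × F),
        TendstoInDistribution
          (fun (n : ℕ) (ω : Ω) => S.restrict (fun p => deletingEmpiricalProcess P F ξ D n p ω))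
          atTop
          (fun ω' : Ω' => S.restrict (fun p => Z p ω'))
          (fun _ => μ) μ' :=
  ⟨exists_isKieferMullerProcess P F fun f hf ↦ (hF f hf).2, fun _ _ _ _ _ hZ S ↦
    hZ.tendstoInDistribution hlaw hindep hF hk hD S⟩
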